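/- Let $U$ be a finite simple unicyclic graph, that is, a connected graph containing exactly one cycle, of order $n\ge 21$ and girth $g$ (the length of its cycle). Let $\mathcal{L}(U)=D^{-1/2}(D-A)D^{-1/2}$ be its normalized Laplacian matrix, where $A$ is the adjacency matrix and $D$ the diagonal matrix of vertex degrees, and let $0=\lambda_1(U)\le\lambda_2(U)\le\cdots\le\lambda_n(U)$ be the eigenvalues of $\mathcal{L}(U)$, counted with multiplicity. If $\lambda_2(U)\ge 1-\frac{\sqrt{6}}{3}$, then $g\le 5$. -/

import Mathlib

namespace SimpleGraph

/-- A graph is unicyclic if it is connected and contains exactly one cycle: there is a cycle, and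
all cycles have the same edges (closed walks that run through one cycle from another start vertex
or in the opposite direction are not counted as different cycles). -/
def IsUnicyclic {V : Type*} (G : SimpleGraph V) : Prop :=
  G.Connected ∧ ∃ (u : V) (c : G.Walk u u), c.IsCycle ∧
    ∀ (v : V) (d : G.Walk v v), d.IsCycle → ∀ e : Sym2 V, e ∈ d.edges ↔ e ∈ c.edges

section NormalizedLaplacian

variable {V : Type*} [Fintype V] [DecidableEq V] (G : SimpleGraph V) [DecidableRel G.Adj]

/-- The diagonal matrix `D ^ (-1/2)`, where `D` is the degree matrix. -/
noncomputable def invSqrtDegMatrix : Matrix V V ℝ :=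
  Matrix.diagonal fun v => (Real.sqrt (G.degree v))⁻¹

/-- The normalized Laplacian matrix `D ^ (-1/2) * (D - A) * D ^ (-1/2)`. -/
noncomputable def normLapMatrix : Matrix V V ℝ :=
  G.invSqrtDegMatrix * G.lapMatrix ℝ * G.invSqrtDegMatrix

theorem isHermitian_normLapMatrix : G.normLapMatrix.IsHermitian := by
  have hD : G.invSqrtDegMatrix.conjTranspose = G.invSqrtDegMatrix := by
    simp [invSqrtDegMatrix]
  have hL : (G.lapMatrix ℝ).conjTranspose = G.lapMatrix ℝ := G.isHermitian_lapMatrix ℝ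
  simp only [Matrix.IsHermitian, normLapMatrix, Matrix.conjTranspose_mul, hD, hL, Matrix.mul_assoc]

/-- The `k`-th smallest eigenvalue of the normalized Laplacian matrix, counted with multiplicity,
for `1 ≤ k ≤ |V|`. Here `Matrix.IsHermitian.eigenvalues₀` lists the eigenvalues in decreasing
order, with indices `0, …, |V| - 1`. -/
noncomputable def normLapEigenvalue (k : ℕ) (hk : 1 ≤ k) (hkV : k ≤ Fintype.card V) : ℝ :=
  G.isHermitian_normLapMatrix.eigenvalues₀ ⟨Fintype.card V - k, by omega⟩

end NormalizedLaplacian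

end SimpleGraph

namespace SimpleGraph

section CycleComponents

variable {V : Type*} {G : SimpleGraph V}

theorem eq_of_reachable_deleteEdges_cycle {u : V} {c : G.Walk u u}
    (hc : ∀ (v : V) (d : G.Walk v v), d.IsCycle → ∀ e : Sym2 V, e ∈ d.edges ↔ e ∈ c.edges)
    {x y : V} (hx : x ∈ c.support) (hy : y ∈ c.support)
    (h : (G.deleteEdges {e | e ∈ c.edges}).Reachable x y) : x = y := by
  classical
  obtain ⟨p, hp⟩ := h.exists_isPath
  cases p with
  | nil => rfl
  | @cons _ w _ hxw q =>
    exfalso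
    have hxw' := hxw
    rw [deleteEdges_adj] at hxw'
    obtain ⟨hadj, hne⟩ := hxw'
    have hbr : G.IsBridge s(x, w) := by
      rw [isBridge_iff_forall_cycle_notMem ((mem_edgeSet G).2 hadj)]
      exact fun v d hd he => hne ((hc v d hd _).1 he)
    rw [isBridge_iff_forall_walk_mem_edges] at hbr
    have hq : s(x, w) ∉ q.edges := by
      have := hp.isTrail
      rw [Walk.isTrail_cons] at this
      exact this.2
    have := hbr ((((c.takeUntil x hx).reverse.append (c.takeUntil y hy)).append
      (q.mapLe (deleteEdges_le _)).reverse))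
    simp only [Walk.edges_append, Walk.edges_reverse, List.mem_append, List.mem_reverse,
      Walk.edges_mapLe_eq_edges] at this
    rcases this with (h | h) | h
    · exact hne (c.edges_takeUntil_subset_edges hx h)
    · exact hne (c.edges_takeUntil_subset_edges hy h)
    · exact hq h

theorem exists_mem_support_reachable_deleteEdges (hG : G.Connected) {u : V} (c : G.Walk u u)
    (v : V) : ∃ x ∈ c.support, (G.deleteEdges {e | e ∈ c.edges}).Reachable v x := by
  obtain ⟨p⟩ := hG.preconnected v u
  induction p with
  | nil => exact ⟨_, c.start_mem_support, Reachable.refl _⟩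
  | @cons v w _ h p ih =>
    by_cases he : s(v, w) ∈ c.edges
    · exact ⟨v, c.fst_mem_support_of_mem_edges he, Reachable.refl _⟩
    · obtain ⟨x, hx, hr⟩ := ih c
      refine ⟨x, hx, Reachable.trans (Adj.reachable ?_) hr⟩
      rw [deleteEdges_adj]
      exact ⟨h, he⟩

theorem ConnectedComponent.two_mul_card_le_sum_degree [Fintype V] [DecidableRel G.Adj]
    (C : G.ConnectedComponent) [DecidablePred (· ∈ C.supp)] :
    2 * (Finset.univ.filter (· ∈ C.supp)).card ≤
      ∑ v ∈ Finset.univ.filter (· ∈ C.supp), G.degree v + 2 := by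
  classical
  have h := C.connected_toSimpleGraph.card_vert_le_card_edgeSet_add_one
  have hs := C.toSimpleGraph.sum_degrees_eq_twice_card_edges
  have hdeg : ∀ v : C, C.toSimpleGraph.degree v = G.degree v.1 := by
    intro v
    rw [← card_neighborFinset_eq_degree, ← card_neighborFinset_eq_degree]
    refine Finset.card_bij (fun w _ => w.1) ?_ ?_ ?_
    · intro w hw
      rw [mem_neighborFinset] at hw ⊢
      exact hw
    · intro a _ b _ hab
      exact Subtype.ext hab
    · intro w hw
      rw [mem_neighborFinset] at hw
      exact ⟨⟨w, C.mem_supp_of_adj_mem_supp v.2 hw⟩, by rw [mem_neighborFinset]; exact hw, rfl⟩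
  have hsum : ∑ v : C, C.toSimpleGraph.degree v =
      ∑ v ∈ Finset.univ.filter (· ∈ C.supp), G.degree v := by
    rw [Finset.sum_congr rfl fun v _ => hdeg v]
    exact (Finset.sum_subtype (Finset.univ.filter (· ∈ C.supp)) (p := (· ∈ C.supp)) (by simp)
      (fun v => G.degree v)).symm
  have hcard : Nat.card C = (Finset.univ.filter (· ∈ C.supp)).card := by
    rw [Nat.card_eq_fintype_card]
    exact Fintype.card_subtype _
  have : Nat.card C.toSimpleGraph.edgeSet = C.toSimpleGraph.edgeFinset.card := by
    rw [Nat.card_eq_fintype_card, edgeFinset_card]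
  omega

theorem degree_deleteEdges_cycle_add_two_le [Fintype V] [DecidableRel G.Adj] {u : V}
    {c : G.Walk u u} (hc : c.IsCycle) [DecidableRel (G.deleteEdges {e | e ∈ c.edges}).Adj]
    {v : V} (hv : v ∈ c.support) :
    (G.deleteEdges {e | e ∈ c.edges}).degree v + 2 ≤ G.degree v := by
  classical
  have h2 := hc.ncard_neighborSet_toSubgraph_eq_two hv
  rw [Set.ncard_eq_toFinset_card'] at h2
  rw [← h2, ← card_neighborFinset_eq_degree, ← card_neighborFinset_eq_degree,
    ← Finset.card_union_of_disjoint]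
  · apply Finset.card_le_card
    intro w hw
    rw [Finset.mem_union, mem_neighborFinset, Set.mem_toFinset, Subgraph.mem_neighborSet] at hw
    rw [mem_neighborFinset]
    rcases hw with hw | hw
    · exact (deleteEdges_le _) hw
    · exact hw.adj_sub
  · rw [Finset.disjoint_left]
    intro w hw hw'
    rw [mem_neighborFinset, deleteEdges_adj] at hw
    rw [Set.mem_toFinset, Subgraph.mem_neighborSet] at hw'
    exact hw.2 ((Walk.mem_edges_toSubgraph c).1 hw')

end CycleComponents
end SimpleGraph

namespace SimpleGraph

section HexagonalPartition

variable {V : Type*} {G : SimpleGraph V}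

theorem exists_cycle_projection {u : V} {c : G.Walk u u} (hG : G.Connected) (hcyc : c.IsCycle)
    (hc : ∀ (v : V) (d : G.Walk v v), d.IsCycle → ∀ e : Sym2 V, e ∈ d.edges ↔ e ∈ c.edges) :
    ∃ r : V → ℕ, (∀ v, r v < c.length) ∧ (∀ i < c.length, r (c.getVert i) = i) ∧
      ∀ v w, r v = r w ↔ (G.deleteEdges {e | e ∈ c.edges}).Reachable v w := by
  have hlen := hcyc.three_le_length
  have hex : ∀ v, ∃ i < c.length,
      (G.deleteEdges {e | e ∈ c.edges}).Reachable v (c.getVert i) := by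
    intro v
    obtain ⟨x, hx, hr⟩ := exists_mem_support_reachable_deleteEdges hG c v
    obtain ⟨i, rfl, hi⟩ := (Walk.mem_support_iff_exists_getVert).1 hx
    rcases hi.lt_or_eq with h | rfl
    · exact ⟨i, h, hr⟩
    · exact ⟨0, by omega, by simpa using hr⟩
  choose r hr hreach using hex
  have hinj : ∀ i < c.length, ∀ j < c.length,
      (G.deleteEdges {e | e ∈ c.edges}).Reachable (c.getVert i) (c.getVert j) → i = j := by
    intro i hi j hj h
    exact hcyc.getVert_injOn' (by simp; omega) (by simp; omega)
      (eq_of_reachable_deleteEdges_cycle hc (c.getVert_mem_support i) (c.getVert_mem_support j) h)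
  refine ⟨r, hr, fun i hi => (hinj _ hi _ (hr _) (hreach _)).symm, fun v w => ⟨fun h => ?_,
    fun h => hinj _ (hr v) _ (hr w) (((hreach v).symm.trans h).trans (hreach w))⟩⟩
  exact (hreach v).trans (h ▸ (hreach w).symm)

theorem exists_hexagonal_partition [Fintype V] [DecidableRel G.Adj] {u : V} {c : G.Walk u u}
    (hG : G.Connected) (hcyc : c.IsCycle)
    (hc : ∀ (v : V) (d : G.Walk v v), d.IsCycle → ∀ e : Sym2 V, e ∈ d.edges ↔ e ∈ c.edges)
    (hlen : 6 ≤ c.length) :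
    ∃ (l : V → Fin 6) (a b : Fin 6 → V), (∀ k, l (a k) = k ∧ l (b k) = k + 1) ∧
      (∀ v w, G.Adj v w → l v = l w ∨ ∃ k, v = a k ∧ w = b k ∨ v = b k ∧ w = a k) ∧
      ∀ h : Fin 6 → ℝ, 0 ≤ h → 2 * ∑ v, h (l v) ≤ ∑ v, G.degree v * h (l v) := by
  classical
  obtain ⟨r, hr, hrc, hreach⟩ := exists_cycle_projection hG hcyc hc
  let m : ℕ → Fin 6 := fun i => ⟨min i 5, by omega⟩
  let s : Fin 6 → ℕ := fun k => if k.1 = 5 then c.length - 1 else k.1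
  have hs : ∀ k, s k < c.length := fun k => by simp only [s]; split_ifs <;> omega
  have h0 : c.getVert c.length = c.getVert 0 := by simp
  refine ⟨fun v => m (r v), fun k => c.getVert (s k), fun k => c.getVert (s k + 1),
    fun k => ⟨?_, ?_⟩, ?_, ?_⟩
  · show m (r (c.getVert (s k))) = k
    rw [hrc _ (hs k)]
    ext
    simp only [m, s]
    split_ifs <;> omega
  · show m (r (c.getVert (s k + 1))) = k + 1
    by_cases hk : k.1 = 5
    · obtain rfl : k = 5 := Fin.ext hk
      have : s 5 + 1 = c.length := by simp [s]; omega
      rw [this, h0, hrc _ (by omega)]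
      rfl
    · have hsk : s k = k.1 := by simp [s, hk]
      rw [hsk, hrc _ (by omega)]
      ext
      rw [Fin.val_add_one_of_lt' (by omega)]
      simp only [m]
      omega
  · intro v w hvw
    by_cases he : s(v, w) ∈ c.edges
    · obtain ⟨i, hi, heq⟩ := (c.mk_mem_edges_iff_exists).1 he
      by_cases hmid : 5 ≤ i ∧ i + 1 < c.length
      · left
        have e : m i = m (i + 1) := by ext; simp only [m]; omega
        have e1 := hrc i hi
        have e2 := hrc (i + 1) hmid.2
        rcases Sym2.eq_iff.1 heq with ⟨rfl, rfl⟩ | ⟨rfl, rfl⟩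
        · show m (r _) = m (r _)
          rw [e1, e2, e]
        · show m (r _) = m (r _)
          rw [e1, e2, e]
      · right
        have : ∃ k, s k = i := by
          by_cases h5 : i < 5
          · exact ⟨⟨i, by omega⟩, by simp only [s]; split_ifs <;> omega⟩
          · exact ⟨5, by simp [s]; omega⟩
        obtain ⟨k, rfl⟩ := this
        refine ⟨k, ?_⟩
        rcases Sym2.eq_iff.1 heq with ⟨h1, h2⟩ | ⟨h1, h2⟩
        · exact Or.inl ⟨h1.symm, h2.symm⟩
        · exact Or.inr ⟨h2.symm, h1.symm⟩
    · left
      have : r v = r w := (hreach v w).2 (Adj.reachable (by rw [deleteEdges_adj]; exact ⟨hvw, he⟩))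
      show m (r v) = m (r w)
      rw [this]
  · intro h hh
    have hfib : ∀ i < c.length, 2 * (Finset.univ.filter (fun v => r v = i)).card ≤
        ∑ v ∈ Finset.univ.filter (fun v => r v = i), G.degree v := by
      intro i hi
      have hset : Finset.univ.filter (fun v => r v = i) = Finset.univ.filter
          (· ∈ ((G.deleteEdges {e | e ∈ c.edges}).connectedComponentMk (c.getVert i)).supp) := by
        ext v
        simp only [Finset.mem_filter, Finset.mem_univ, true_and, ConnectedComponent.mem_supp_iff,
          ConnectedComponent.eq]
        rw [← hreach, hrc i hi]
      have h1 := ((G.deleteEdges {e | e ∈ c.edges}).connectedComponentMk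
        (c.getVert i)).two_mul_card_le_sum_degree
      rw [← hset] at h1
      have hmem : c.getVert i ∈ Finset.univ.filter (fun v => r v = i) := by simp [hrc i hi]
      rw [← Finset.add_sum_erase _ _ hmem] at h1 ⊢
      have h2 := degree_deleteEdges_cycle_add_two_le hcyc (c.getVert_mem_support i)
      have h3 : ∑ v ∈ (Finset.univ.filter (fun v => r v = i)).erase (c.getVert i),
          (G.deleteEdges {e | e ∈ c.edges}).degree v ≤
          ∑ v ∈ (Finset.univ.filter (fun v => r v = i)).erase (c.getVert i), G.degree v :=
        Finset.sum_le_sum fun v _ => degree_le_of_le (deleteEdges_le _)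
      omega
    have hmaps : ∀ v ∈ (Finset.univ : Finset V), r v ∈ Finset.range c.length :=
      fun v _ => Finset.mem_range.2 (hr v)
    rw [Finset.mul_sum, ← Finset.sum_fiberwise_of_maps_to hmaps,
      ← Finset.sum_fiberwise_of_maps_to hmaps]
    refine Finset.sum_le_sum fun i hi => ?_
    have e1 : ∑ v ∈ Finset.univ.filter (fun v => r v = i), 2 * h (m (r v)) =
        ((2 * (Finset.univ.filter (fun v => r v = i)).card : ℕ) : ℝ) * h (m i) := by
      rw [Finset.sum_congr rfl (g := fun _ => 2 * h (m i))]
      · simp; ring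
      · intro v hv
        rw [(Finset.mem_filter.1 hv).2]
    have e2 : ∑ v ∈ Finset.univ.filter (fun v => r v = i), (G.degree v : ℝ) * h (m (r v)) =
        ((∑ v ∈ Finset.univ.filter (fun v => r v = i), G.degree v : ℕ) : ℝ) * h (m i) := by
      rw [Nat.cast_sum, Finset.sum_mul]
      refine Finset.sum_congr rfl fun v hv => ?_
      rw [(Finset.mem_filter.1 hv).2]
    rw [e1, e2]
    exact mul_le_mul_of_nonneg_right (Nat.cast_le.2 (hfib i (Finset.mem_range.1 hi))) (hh _)

end HexagonalPartition
end SimpleGraph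

theorem EuclideanSpace.real_inner_toLp {n : Type*} [Fintype n] (y z : n → ℝ) :
    inner ℝ (WithLp.toLp 2 y : EuclideanSpace ℝ n) (WithLp.toLp 2 z) = y ⬝ᵥ z := by
  simp [EuclideanSpace.inner_eq_star_dotProduct, dotProduct_comm]

theorem Matrix.IsHermitian.dotProduct_mulVec_eq_sum {n : Type*} [Fintype n] [DecidableEq n]
    {A : Matrix n n ℝ} (hA : A.IsHermitian) (x : n → ℝ) :
    x ⬝ᵥ A.mulVec x = ∑ j, hA.eigenvalues j * (hA.eigenvectorBasis j ⬝ᵥ x) ^ 2 := by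
  have h := hA.eigenvectorBasis.sum_inner_mul_inner (WithLp.toLp 2 x) (WithLp.toLp 2 (A.mulVec x))
  rw [EuclideanSpace.real_inner_toLp] at h
  rw [← h]
  refine Finset.sum_congr rfl fun j _ => ?_
  have hT : A.transpose = A := by
    have := hA
    rwa [Matrix.IsHermitian, Matrix.conjTranspose_eq_transpose_of_trivial] at this
  have e1 : inner ℝ (WithLp.toLp 2 x) (hA.eigenvectorBasis j) =
      hA.eigenvectorBasis j ⬝ᵥ x := by
    rw [dotProduct_comm]
    exact EuclideanSpace.real_inner_toLp x (hA.eigenvectorBasis j)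
  have e2 : inner ℝ (hA.eigenvectorBasis j) (WithLp.toLp 2 (A.mulVec x)) =
      hA.eigenvalues j * (hA.eigenvectorBasis j ⬝ᵥ x) := by
    refine (EuclideanSpace.real_inner_toLp (hA.eigenvectorBasis j) (A.mulVec x)).trans ?_
    rw [Matrix.dotProduct_mulVec, ← Matrix.mulVec_transpose, hT, hA.mulVec_eigenvectorBasis,
      smul_dotProduct, smul_eq_mul]
  rw [e1, e2]
  ring

theorem Matrix.IsHermitian.dotProduct_self_eq_sum {n : Type*} [Fintype n] [DecidableEq n]
    {A : Matrix n n ℝ} (hA : A.IsHermitian) (x : n → ℝ) :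
    x ⬝ᵥ x = ∑ j, (hA.eigenvectorBasis j ⬝ᵥ x) ^ 2 := by
  have h := hA.eigenvectorBasis.sum_inner_mul_inner (WithLp.toLp 2 x) (WithLp.toLp 2 x)
  rw [EuclideanSpace.real_inner_toLp] at h
  rw [← h]
  refine Finset.sum_congr rfl fun j _ => ?_
  rw [sq, real_inner_comm]
  congr 1 <;> exact EuclideanSpace.real_inner_toLp (hA.eigenvectorBasis j) x

/-- Two vectors span a nonzero vector on which the quadratic form is at least the second smallest
eigenvalue times the squared norm. -/
theorem Matrix.IsHermitian.exists_eigenvalues₀_mul_le {n : Type*} [Fintype n] [DecidableEq n]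
    {A : Matrix n n ℝ} (hA : A.IsHermitian) (h2 : 2 ≤ Fintype.card n) (x y : n → ℝ) :
    ∃ s t : ℝ, (s ≠ 0 ∨ t ≠ 0) ∧
      hA.eigenvalues₀ ⟨Fintype.card n - 2, by omega⟩ * ((s • x + t • y) ⬝ᵥ (s • x + t • y)) ≤
        (s • x + t • y) ⬝ᵥ A.mulVec (s • x + t • y) := by
  let e : Fin (Fintype.card n) ≃ n := Fintype.equivOfCardEq (Fintype.card_fin _)
  let j₀ : n := e ⟨Fintype.card n - 1, by omega⟩
  obtain ⟨s, t, hst, horth⟩ : ∃ s t : ℝ, (s ≠ 0 ∨ t ≠ 0) ∧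
      hA.eigenvectorBasis j₀ ⬝ᵥ (s • x + t • y) = 0 := by
    by_cases h : hA.eigenvectorBasis j₀ ⬝ᵥ x = 0
    · exact ⟨1, 0, by simp, by simp [h]⟩
    · refine ⟨-(hA.eigenvectorBasis j₀ ⬝ᵥ y), hA.eigenvectorBasis j₀ ⬝ᵥ x, Or.inr h, ?_⟩
      rw [dotProduct_add, dotProduct_smul, dotProduct_smul, smul_eq_mul, smul_eq_mul]
      ring
  refine ⟨s, t, hst, ?_⟩
  rw [hA.dotProduct_mulVec_eq_sum, hA.dotProduct_self_eq_sum, Finset.mul_sum]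
  refine Finset.sum_le_sum fun j _ => ?_
  by_cases hj : j = j₀
  · rw [hj, horth]
    simp
  · refine mul_le_mul_of_nonneg_right (hA.eigenvalues₀_antitone ?_) (sq_nonneg _)
    rw [Fin.le_def]
    have h1 := (e.symm j).2
    have h3 : (e.symm j).1 ≠ Fintype.card n - 1 := by
      intro h
      exact hj (by rw [← e.apply_symm_apply j]; exact congrArg e (Fin.ext h))
    show (e.symm j).1 ≤ Fintype.card n - 2
    omega

namespace SimpleGraph

theorem exists_normLapEigenvalue_two_mul_le {V : Type*} [Fintype V] [DecidableEq V]
    (G : SimpleGraph V) [DecidableRel G.Adj] (hdeg : ∀ v, 0 < G.degree v)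
    (h2 : 2 ≤ Fintype.card V) (f : V → ℝ) :
    ∃ s t : ℝ, (s ≠ 0 ∨ t ≠ 0) ∧
      G.normLapEigenvalue 2 one_le_two h2 * ∑ v, G.degree v * (s + t * f v) ^ 2 ≤
        t ^ 2 * ((∑ v, ∑ w, if G.Adj v w then (f v - f w) ^ 2 else 0) / 2) := by
  obtain ⟨s, t, hst, h⟩ := G.isHermitian_normLapMatrix.exists_eigenvalues₀_mul_le h2
    (fun v => √(G.degree v)) (fun v => √(G.degree v) * f v)
  refine ⟨s, t, hst, ?_⟩
  have hz : s • (fun v => √(G.degree v : ℝ)) + t • (fun v => √(G.degree v : ℝ) * f v) =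
      fun v => √(G.degree v : ℝ) * (s + t * f v) := by
    ext v
    simp only [Pi.add_apply, Pi.smul_apply, smul_eq_mul]
    ring
  rw [hz] at h
  have e1 : (fun v => √(G.degree v : ℝ) * (s + t * f v)) ⬝ᵥ
      (fun v => √(G.degree v : ℝ) * (s + t * f v)) = ∑ v, G.degree v * (s + t * f v) ^ 2 := by
    refine Finset.sum_congr rfl fun v _ => ?_
    have := Real.mul_self_sqrt (Nat.cast_nonneg (α := ℝ) (G.degree v))
    linear_combination (s + t * f v) ^ 2 * this
  have e3 : G.invSqrtDegMatrix.mulVec (fun v => √(G.degree v : ℝ) * (s + t * f v)) =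
      fun v => s + t * f v := by
    ext v
    have : √(G.degree v : ℝ) ≠ 0 := (Real.sqrt_pos.2 (Nat.cast_pos.2 (hdeg v))).ne'
    rw [invSqrtDegMatrix, Matrix.mulVec_diagonal]
    field_simp
  have e2 : (fun v => √(G.degree v : ℝ) * (s + t * f v)) ⬝ᵥ
      G.normLapMatrix.mulVec (fun v => √(G.degree v : ℝ) * (s + t * f v)) =
      t ^ 2 * ((∑ v, ∑ w, if G.Adj v w then (f v - f w) ^ 2 else 0) / 2) := by
    have e4 : Matrix.vecMul (fun v => √(G.degree v : ℝ) * (s + t * f v)) G.invSqrtDegMatrix =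
        fun v => s + t * f v := by
      rw [← e3, ← Matrix.vecMul_transpose, invSqrtDegMatrix, Matrix.diagonal_transpose]
    rw [normLapMatrix, ← Matrix.mulVec_mulVec, e3, ← Matrix.mulVec_mulVec,
      Matrix.dotProduct_mulVec, e4, ← Matrix.toLinearMap₂'_apply', lapMatrix_toLinearMap₂',
      mul_div_assoc', Finset.mul_sum]
    congr 1
    refine Finset.sum_congr rfl fun v _ => ?_
    rw [Finset.mul_sum]
    refine Finset.sum_congr rfl fun w _ => ?_
    split_ifs
    · ring
    · ring
  rw [e1, e2] at h
  exact h

end SimpleGraph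

theorem hexagon_weights {a b c d e f : ℕ} (ha : 1 ≤ a) (hb : 1 ≤ b) (hc : 1 ≤ c) (hd : 1 ≤ d)
    (he : 1 ≤ e) (hf : 1 ≤ f) (hs : a + b + c + d + e + f = 21)
    (hba : b ≤ a) (hca : c ≤ a) (hda : d ≤ a) (hea : e ≤ a) (hfa : f ≤ a) :
    (229 ≤ (b + f) * (a + (c + d + e)) + 4 * a * (c + d + e) ∨
      573 ≤ 4 * (b + f) * a + 9 * a * (c + d + e) + (b + f) * (c + d + e)) ∨
    (229 ≤ (a + c) * (b + (d + e + f)) + 4 * b * (d + e + f)) ∨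
    (229 ≤ (e + a) * (f + (b + c + d)) + 4 * f * (b + c + d)) := by
  obtain ⟨z, hz⟩ : ∃ z, b + f = z := ⟨_, rfl⟩
  obtain ⟨y, hy⟩ : ∃ y, c + d + e = y := ⟨_, rfl⟩
  rw [hz, hy]
  have h1 : a ≤ 16 := by omega
  have h2 : 4 ≤ a := by omega
  have h3 : z ≤ 12 := by omega
  have h4 : 2 ≤ z := by omega
  obtain rfl : y = 21 - a - z := by omega
  by_cases hz8 : z ≤ 7
  · left; left
    interval_cases z <;> interval_cases a <;> omega
  by_cases hG : 229 ≤ z * (a + (21 - a - z)) + 4 * a * (21 - a - z) ∨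
      573 ≤ 4 * z * a + 9 * a * (21 - a - z) + z * (21 - a - z)
  · exact Or.inl hG
  right
  have hy3 : 3 ≤ 21 - a - z := by omega
  have key : ∀ u v w : ℕ, u + v + w = 21 → 4 ≤ u → 3 ≤ v →
    (v ≤ 7 ∨ v = 8 ∧ u ≤ 9 ∨ v = 9 ∧ u ≤ 8) → 3 ≤ w → 229 ≤ v * (u + w) + 4 * u * w := by
    intro u v w h hu hv h9 hw
    obtain rfl : w = 21 - u - v := by omega
    have : v ≤ 9 := by omega
    interval_cases v <;> (have : u ≤ 15 := by omega) <;> interval_cases u <;> omega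
  have hG' : (z = 10 ∧ (a = 7 ∨ a = 8)) ∨ (z = 11 ∧ (a = 6 ∨ a = 7)) ∨ (z = 12 ∧ a = 6) := by
    interval_cases z <;> interval_cases a <;> omega
  rcases le_total b f with h | h
  · right
    apply key <;> omega
  · left
    apply key <;> omega

theorem exists_le_sum_eq {ι : Type*} [Fintype ι] [DecidableEq ι] {m : ℕ}
    (hm : Fintype.card ι ≤ m) (N : ι → ℕ) (hN : ∀ k, 1 ≤ N k) (hs : m ≤ ∑ k, N k) :
    ∃ w : ι → ℕ, (∀ k, 1 ≤ w k) ∧ (∀ k, w k ≤ N k) ∧ ∑ k, w k = m := by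
  obtain ⟨d, hd⟩ := Nat.exists_eq_add_of_le hs
  induction d generalizing N with
  | zero => exact ⟨N, hN, fun _ => le_rfl, hd⟩
  | succ d ih =>
    obtain ⟨k, hk⟩ : ∃ k, 2 ≤ N k := by
      by_contra! h
      have : ∑ k, N k ≤ ∑ _k : ι, 1 := Finset.sum_le_sum fun k _ => Nat.le_of_lt_succ (h k)
      simp at this
      omega
    have hsum : ∑ j, Function.update N k (N k - 1) j + 1 = ∑ j, N j := by
      rw [Finset.sum_update_of_mem (Finset.mem_univ k), ← Finset.erase_eq,
        ← Finset.add_sum_erase _ N (Finset.mem_univ k)]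
      omega
    have hle : ∀ j, Function.update N k (N k - 1) j ≤ N j := by
      intro j
      rcases eq_or_ne j k with rfl | h
      · simp
      · simp [h]
    obtain ⟨w, h1, h2, h3⟩ := ih (Function.update N k (N k - 1)) (by
      intro j
      rcases eq_or_ne j k with rfl | h
      · simp; omega
      · simp [h, hN j]) (by omega) (by omega)
    exact ⟨w, h1, fun j => (h2 j).trans (hle j), h3⟩

theorem Fin.sum_univ_six_add {M : Type*} [AddCommMonoid M] (F : Fin 6 → M) (i : Fin 6) :
    ∑ k, F k = F i + F (i + 1) + F (i + 2) + F (i + 3) + F (i + 4) + F (i + 5) := by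
  rw [← Equiv.sum_comp (Equiv.addLeft i) F, Fin.sum_univ_six]
  simp

theorem exists_hexagon_weights (w : Fin 6 → ℕ) (hw : ∀ k, 1 ≤ w k) (hs : ∑ k, w k = 21) :
    ∃ (i : Fin 6) (p z b : ℕ), w i = p ∧ w (i + 1) + w (i + 5) = z ∧
      w (i + 2) + w (i + 3) + w (i + 4) = b ∧
      (229 ≤ z * (p + b) + 4 * p * b ∨ 573 ≤ 4 * z * p + 9 * p * b + z * b) := by
  obtain ⟨i, -, hi⟩ := Finset.exists_max_image Finset.univ w ⟨0, Finset.mem_univ _⟩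
  have h (j : Fin 6) : w j ≤ w i := hi j (Finset.mem_univ j)
  rw [Fin.sum_univ_six_add w i] at hs
  have e (a b c : Fin 6) (h : a + b = c) : i + a + b = i + c := by rw [add_assoc, h]
  rcases hexagon_weights (hw i) (hw _) (hw _) (hw _) (hw _) (hw _) hs (h _) (h _) (h _) (h _) (h _)
    with h | h | h
  · exact ⟨i, _, _, _, rfl, rfl, rfl, h⟩
  · refine ⟨i + 1, _, _, _, rfl, rfl, rfl, Or.inl ?_⟩
    rw [e 1 1 2 rfl, e 1 2 3 rfl, e 1 3 4 rfl, e 1 4 5 rfl, e 1 5 0 rfl, add_zero,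
      add_comm (w (i + 2))]
    exact h
  · refine ⟨i + 5, _, _, _, rfl, rfl, rfl, Or.inl ?_⟩
    rw [e 5 1 0 rfl, e 5 2 1 rfl, e 5 3 2 rfl, e 5 4 3 rfl, e 5 5 4 rfl, add_zero,
      add_comm (w i)]
    exact h

namespace SimpleGraph

variable {V : Type*} [Fintype V] {G : SimpleGraph V} [DecidableRel G.Adj]

theorem energy_le_of_hexagonal_partition {l : V → Fin 6} {a b : Fin 6 → V}
    (hab : ∀ k, l (a k) = k ∧ l (b k) = k + 1)
    (hadj : ∀ v w, G.Adj v w → l v = l w ∨ ∃ k, v = a k ∧ w = b k ∨ v = b k ∧ w = a k)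
    (x : Fin 6 → ℝ) :
    (∑ v, ∑ w, if G.Adj v w then (x (l v) - x (l w)) ^ 2 else 0) / 2 ≤
      ∑ k, (x k - x (k + 1)) ^ 2 := by
  classical
  have hle : ∀ v w, (if G.Adj v w then (x (l v) - x (l w)) ^ 2 else 0) ≤
      ∑ k, ((if v = a k then if w = b k then (x k - x (k + 1)) ^ 2 else 0 else 0) +
        if v = b k then if w = a k then (x k - x (k + 1)) ^ 2 else 0 else 0) := by
    intro v w
    have hnn : ∀ k ∈ Finset.univ, 0 ≤
        (if v = a k then if w = b k then (x k - x (k + 1)) ^ 2 else 0 else 0) +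
        if v = b k then if w = a k then (x k - x (k + 1)) ^ 2 else 0 else 0 := by
      intro k _
      have := sq_nonneg (x k - x (k + 1))
      split_ifs <;> linarith
    split_ifs with hvw
    · rcases hadj v w hvw with h | ⟨k, h⟩
      · rw [h, sub_self, zero_pow two_ne_zero]
        exact Finset.sum_nonneg hnn
      · refine le_trans ?_ (Finset.single_le_sum hnn (Finset.mem_univ k))
        have := sq_nonneg (x k - x (k + 1))
        rcases h with ⟨rfl, rfl⟩ | ⟨rfl, rfl⟩
        · rw [(hab k).1, (hab k).2]
          simp only [if_true]
          split_ifs <;> linarith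
        · rw [(hab k).1, (hab k).2]
          simp only [if_true]
          split_ifs <;> nlinarith
    · exact Finset.sum_nonneg hnn
  have h := Finset.sum_le_sum fun v (_ : v ∈ Finset.univ) =>
    Finset.sum_le_sum fun w (_ : w ∈ Finset.univ) => hle v w
  have h2 : ∑ v, ∑ w, ∑ k,
      ((if v = a k then if w = b k then (x k - x (k + 1)) ^ 2 else 0 else 0) +
        if v = b k then if w = a k then (x k - x (k + 1)) ^ 2 else 0 else 0) =
      2 * ∑ k, (x k - x (k + 1)) ^ 2 := by
    rw [Finset.sum_congr rfl fun v _ => Finset.sum_comm, Finset.sum_comm, Finset.mul_sum]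
    refine Finset.sum_congr rfl fun k _ => ?_
    have hpair : ∀ (a b : V) (y : ℝ),
        ∑ v, ∑ w, (if v = a then if w = b then y else 0 else 0) = y := by
      intro a b y
      rw [Finset.sum_eq_single a (fun v _ hv => by simp [hv]) (by simp)]
      simp
    simp only [Finset.sum_add_distrib, hpair, two_mul]
  rw [h2] at h
  linarith

theorem sum_mul_le_of_hexagonal_partition {l : V → Fin 6} (x : Fin 6 → ℝ)
    (hvol : ∀ h : Fin 6 → ℝ, 0 ≤ h → 2 * ∑ v, h (l v) ≤ ∑ v, G.degree v * h (l v))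
    {w : Fin 6 → ℕ} (hw : ∀ k, w k ≤ (Finset.univ.filter (fun v => l v = k)).card) (hx : 0 ≤ x) :
    2 * ∑ k, w k * x k ≤ ∑ v, G.degree v * x (l v) := by
  refine le_trans (mul_le_mul_of_nonneg_left ?_ zero_le_two) (hvol x hx)
  rw [← Finset.sum_fiberwise Finset.univ l]
  refine Finset.sum_le_sum fun k _ => ?_
  rw [Finset.sum_congr rfl (g := fun _ => x k) fun v hv => by rw [(Finset.mem_filter.1 hv).2],
    Finset.sum_const, nsmul_eq_mul]
  exact mul_le_mul_of_nonneg_right (Nat.cast_le.2 (hw k)) (hx k)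

theorem normLapEigenvalue_two_mul_le_of_hexagonal_partition [DecidableEq V]
    (hdeg : ∀ v, 0 < G.degree v) (h2 : 2 ≤ Fintype.card V)
    (hpos : 0 < G.normLapEigenvalue 2 one_le_two h2) {l : V → Fin 6} {a b : Fin 6 → V}
    (hab : ∀ k, l (a k) = k ∧ l (b k) = k + 1)
    (hadj : ∀ v w, G.Adj v w → l v = l w ∨ ∃ k, v = a k ∧ w = b k ∨ v = b k ∧ w = a k)
    (hvol : ∀ h : Fin 6 → ℝ, 0 ≤ h → 2 * ∑ v, h (l v) ≤ ∑ v, G.degree v * h (l v))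
    {w : Fin 6 → ℕ} (hw : ∀ k, w k ≤ (Finset.univ.filter (fun v => l v = k)).card)
    (hs : ∑ k, w k = 21) {i : Fin 6} {p z r : ℕ} (hp : w i = p)
    (hz : w (i + 1) + w (i + 5) = z) (hr : w (i + 2) + w (i + 3) + w (i + 4) = r) (α β γ : ℝ) :
    G.normLapEigenvalue 2 one_le_two h2 *
        (2 * (p * z * (α - β) ^ 2 + p * r * (α - γ) ^ 2 + z * r * (β - γ) ^ 2)) ≤
      21 * (2 * (α - β) ^ 2 + 2 * (β - γ) ^ 2) := by
  let x : Fin 6 → ℝ := fun k => ![α, β, γ, γ, γ, β] (k - i)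
  have x0 : x i = α := by simp [x]
  have x1 : x (i + 1) = β := by simp [x]
  have x2 : x (i + 2) = γ := by simp [x]
  have x3 : x (i + 3) = γ := by simp [x]
  have x4 : x (i + 4) = γ := by simp [x]
  have x5 : x (i + 5) = β := by simp [x]
  obtain ⟨s, t, hst, h⟩ := G.exists_normLapEigenvalue_two_mul_le hdeg h2 (fun v => x (l v))
  have hE := energy_le_of_hexagonal_partition hab hadj x
  have e (a b c : Fin 6) (h : a + b = c) : i + a + b = i + c := by rw [add_assoc, h]
  rw [Fin.sum_univ_six_add _ i, e 1 1 2 rfl, e 2 1 3 rfl, e 3 1 4 rfl, e 4 1 5 rfl, e 5 1 0 rfl,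
    add_zero, x0, x1, x2, x3, x4, x5] at hE
  have hW := sum_mul_le_of_hexagonal_partition (fun k => (s + t * x k) ^ 2) hvol hw
    (fun k => sq_nonneg _)
  rw [Fin.sum_univ_six_add _ i, x0, x1, x2, x3, x4, x5] at hW
  rw [Fin.sum_univ_six_add w i] at hs
  have hs' : (p + z + r : ℝ) = 21 := by
    rw [← hp, ← hz, ← hr]
    exact_mod_cast (by omega : w i + (w (i + 1) + w (i + 5)) +
      (w (i + 2) + w (i + 3) + w (i + 4)) = 21)
  have hW' : 2 * (p * (s + t * α) ^ 2 + z * (s + t * β) ^ 2 + r * (s + t * γ) ^ 2) ≤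
      ∑ v, G.degree v * (s + t * x (l v)) ^ 2 := by
    refine le_trans (le_of_eq ?_) hW
    rw [← hp, ← hz, ← hr]
    push_cast
    ring
  generalize G.normLapEigenvalue 2 one_le_two h2 = lam at h hpos ⊢
  have h' := (mul_le_mul_of_nonneg_left hW' hpos.le).trans
    (h.trans (mul_le_mul_of_nonneg_left hE (sq_nonneg t)))
  have ht : t ≠ 0 := by
    rintro rfl
    have hs0 : s ≠ 0 := by simpa using hst
    have h3 : lam * (2 * (21 * s ^ 2)) ≤ 0 := by
      rw [← hs']
      linarith
    have : 0 < lam * (2 * (21 * s ^ 2)) := by positivity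
    linarith
  have hvar : t ^ 2 * (p * z * (α - β) ^ 2 + p * r * (α - γ) ^ 2 + z * r * (β - γ) ^ 2) ≤
      21 * (p * (s + t * α) ^ 2 + z * (s + t * β) ^ 2 + r * (s + t * γ) ^ 2) := by
    rw [← hs']
    linarith [sq_nonneg (p * (s + t * α) + z * (s + t * β) + r * (s + t * γ))]
  have h4 := mul_le_mul_of_nonneg_left hvar hpos.le
  refine le_of_mul_le_mul_left ?_ (by positivity : 0 < t ^ 2)
  linarith

end SimpleGraph

theorem lemma6 {V : Type*} [Fintype V] [DecidableEq V] (U : SimpleGraph V) [DecidableRel U.Adj]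
    (hU : U.IsUnicyclic) (hn : 21 ≤ Fintype.card V)
    (hlam : 1 - Real.sqrt 6 / 3 ≤
      U.normLapEigenvalue 2 one_le_two (le_trans (by norm_num) hn)) :
    U.girth ≤ 5 := by
  by_contra! hg
  obtain ⟨hconn, u, c, hcyc, hc⟩ := hU
  have hlen : 6 ≤ c.length := Nat.succ_le_of_lt (hg.trans_le (SimpleGraph.girth_le_length hcyc))
  obtain ⟨l, a, b, hab, hadj, hvol⟩ :=
    SimpleGraph.exists_hexagonal_partition hconn hcyc hc hlen
  obtain ⟨w, hw1, hw, hs⟩ := exists_le_sum_eq (m := 21) (by simp)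
    (fun k => (Finset.univ.filter (fun v => l v = k)).card)
    (fun k => Finset.card_pos.2 ⟨a k, by simp [hab k]⟩)
    (by rwa [← Finset.card_eq_sum_card_fiberwise (fun _ _ => Finset.mem_univ _),
      Finset.card_univ])
  obtain ⟨i, p, z, r, hp, hz, hr, hgood⟩ := exists_hexagon_weights w hw1 hs
  have : Nontrivial V := Fintype.one_lt_card_iff_nontrivial.1 (by omega)
  have hdeg : ∀ v, 0 < U.degree v := fun v => hconn.preconnected.degree_pos_of_nontrivial v
  have h6 : √6 < 2.4496 := by
    rw [Real.sqrt_lt' (by norm_num)]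
    norm_num
  have hlow : 0.18346 < U.normLapEigenvalue 2 one_le_two (le_trans (by norm_num) hn) := by
    linarith
  have key := SimpleGraph.normLapEigenvalue_two_mul_le_of_hexagonal_partition hdeg
    (le_trans (by norm_num) hn) (by linarith) hab hadj hvol hw hs hp hz hr
  generalize U.normLapEigenvalue 2 one_le_two (le_trans (by norm_num) hn) = lam at hlow key
  rcases hgood with hQ | hQ
  · have hQ' : (229 : ℝ) ≤ z * (p + r) + 4 * p * r := by exact_mod_cast hQ
    nlinarith [key (-1) 0 1]
  · have hQ' : (573 : ℝ) ≤ 4 * z * p + 9 * p * r + z * r := by exact_mod_cast hQ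
    nlinarith [key 3 1 0]
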